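/- **Setting.** A seller offers $n$ items to one buyer whose type is a monotone valuation $v:2^{[n]}\to\mathbb{R}_{\ge 0}$ drawn from a (discrete) probability distribution $\mathcal D$. A valuation is XOS if it is the pointwise maximum of finitely many additive functions with non-negative weights. A lottery $\lambda=(x,p)$ is a random set of items with law $x$ together with a price $p\ge 0$; its utility to the type $v$ is $\mathbb{E}_{S\sim x}[v(S)]-p$. A mechanism is a (possibly infinite) menu of lotteries that contains the null lottery (receive nothing, pay nothing); the buyer purchases a utility-maximizing lottery, ties being broken in favour of the seller (a type without a utility-maximizing lottery is counted as paying $0$), and $\mathrm{Rev}_{\mathcal D}(\mathcal M)$ is the expected payment. The buy-many mechanism generated by a set $\Lambda$ of lotteries lets the buyer adaptively purchase a finite or infinite sequence of lotteries from $\Lambda$, each choice depending on the sets received so far; he obtains the union of all sets received and pays the sum of the prices. Equivalently, it is the mechanism whose menu consists of the outcomes (law of the union, expected total price) of all adaptive strategies of finite expected total price. $\mathrm{BuyManyRev}(\mathcal D)$ is the supremum of $\mathrm{Rev}_{\mathcal D}$ over all buy-many mechanisms in which every type in the support of $\mathcal D$ has an optimal choice. An encoding is an arbitrary map from finite bit strings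 to mechanisms on $n$ items; a mechanism is described by $b$ bits if it is the image of a string of length $b$. **Theorem.** There are absolute constants $c,\delta>0$ and $n_0\in\mathbb{N}$ such that for every $n\ge n_0$ and every encoding of mechanisms on $n$ items there is a distribution $\mathcal D$ over XOS valuations $v$ on $n$ items, all with $1\le v([n])\le n$, such that $$\mathrm{BuyManyRev}(\mathcal D)\;\ge\; c\,\log n\cdot \mathrm{Rev}_{\mathcal D}(\mathcal M)$$ for every mechanism $\mathcal M$ that the encoding describes by at most $\delta\, n^{-1/2}\,2^{2^{n^{1/4}/4}}$ bits. In particular, for every encoding the optimal buy-many revenue exceeds, by a factor $\Omega(\log n)$, the revenue of every mechanism that can be described by $o\big(n^{-1/2}\,2^{2^{n^{1/4}/4}}\big)$ bits. -/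

import Mathlib

open Filter Topology
open scoped NNReal ENNReal

noncomputable section

/-- A buyer's type over the items `Fin n`: a non-negative, monotone set function. -/
structure BuyerValuation (n : ℕ) where
  val : Finset (Fin n) → ℝ≥0
  mono : ∀ S T : Finset (Fin n), S ⊆ T → val S ≤ val T

/-- XOS: a pointwise maximum of finitely many additive functions with non-negative weights. -/
def BuyerValuation.IsXOS {n : ℕ} (v : BuyerValuation n) : Prop :=
  ∃ F : Finset (Fin n → ℝ≥0), ∀ S : Finset (Fin n), v.val S = F.sup (fun a => ∑ i ∈ S, a i)

/-- A lottery: a randomized allocation (a probability distribution over sets of items) and a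
non-negative price. -/
structure Lottery (n : ℕ) where
  alloc : PMF (Finset (Fin n))
  price : ℝ≥0

/-- The trivial lottery: nothing is allocated and nothing is paid. -/
def Lottery.null (n : ℕ) : Lottery n := ⟨PMF.pure ∅, 0⟩

/-- Quasi-linear utility of a lottery: expected value of the allocated set minus the price. -/
def Lottery.utility {n : ℕ} (v : BuyerValuation n) (l : Lottery n) : ℝ :=
  (∑ S : Finset (Fin n), (l.alloc S).toReal * (v.val S : ℝ)) - (l.price : ℝ)

/-- A single-buyer mechanism, given by its menu of lotteries; the buyer may always abstain. -/
structure Mechanism (n : ℕ) where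
  menu : Set (Lottery n)
  null_mem : Lottery.null n ∈ menu

/-- `l` is a utility-maximizing choice of the buyer of type `v`. -/
def Mechanism.IsBestChoice {n : ℕ} (M : Mechanism n) (v : BuyerValuation n) (l : Lottery n) : Prop :=
  l ∈ M.menu ∧ ∀ l' ∈ M.menu, l'.utility v ≤ l.utility v

/-- Payment of the buyer of type `v`: the price of a utility-maximizing choice, where ties are
broken in favour of the seller. -/
def Mechanism.payment {n : ℕ} (M : Mechanism n) (v : BuyerValuation n) : ℝ≥0∞ :=
  ⨆ (l : Lottery n) (_ : M.IsBestChoice v l), (l.price : ℝ≥0∞)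

/-- Expected revenue when the type is drawn from `D`. -/
def Mechanism.revenue {n : ℕ} (M : Mechanism n) (D : PMF (BuyerValuation n)) : ℝ≥0∞ :=
  ∑' v : BuyerValuation n, D v * M.payment v

/-- Every type in the support of `D` has a utility-maximizing choice. -/
def Mechanism.WellPosed {n : ℕ} (M : Mechanism n) (D : PMF (BuyerValuation n)) : Prop :=
  ∀ v ∈ D.support, ∃ l : Lottery n, M.IsBestChoice v l

/-- An adaptive purchasing strategy: given the sets received so far (most recent first), either
stop (`none`) or buy a further lottery.  The strategy may go on for ever. -/
abbrev Strategy (n : ℕ) : Type := List (Finset (Fin n)) → Option (Lottery n)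

/-- The strategy only buys lotteries from `L`. -/
def Strategy.Uses {n : ℕ} (A : Strategy n) (L : Set (Lottery n)) : Prop :=
  ∀ (h : List (Finset (Fin n))) (l : Lottery n), A h = some l → l ∈ L

/-- Distribution of the next history: each purchased lottery is drawn independently. -/
def Strategy.step {n : ℕ} (A : Strategy n) (h : List (Finset (Fin n))) :
    PMF (List (Finset (Fin n))) :=
  match A h with
  | none => PMF.pure h
  | some l => l.alloc.map (fun S => S :: h)

/-- Distribution of the history after (at most) `k` purchases. -/
def Strategy.run {n : ℕ} (A : Strategy n) : ℕ → PMF (List (Finset (Fin n)))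
  | 0 => PMF.pure []
  | k + 1 => (A.run k).bind A.step

/-- All the items acquired along a history: the union of the sets received. -/
def acquired {n : ℕ} (h : List (Finset (Fin n))) : Finset (Fin n) :=
  h.foldr (fun S T => S ∪ T) ∅

/-- The price that the strategy pays next, after history `h` (`0` if it stops). -/
def Strategy.nextPrice {n : ℕ} (A : Strategy n) (h : List (Finset (Fin n))) : ℝ≥0 :=
  match A h with
  | none => 0
  | some l => l.price

/-- Expected total payment of the strategy; it may be infinite. -/
def Strategy.cost {n : ℕ} (A : Strategy n) : ℝ≥0∞ :=
  ∑' k : ℕ, ∑' h : List (Finset (Fin n)), A.run k h * (A.nextPrice h : ℝ≥0∞)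

/-- `l` is the single lottery equivalent to the strategy: its allocation is the law of the union of
all sets ever received and its price is the expected total payment.  (A strategy of infinite
expected payment has utility `-∞` and yields no lottery.) -/
def Strategy.HasOutcome {n : ℕ} (A : Strategy n) (l : Lottery n) : Prop :=
  (∀ S : Finset (Fin n),
    Tendsto (fun k => ((A.run k).map acquired) S) atTop (𝓝 (l.alloc S))) ∧
  A.cost = (l.price : ℝ≥0∞)

theorem Strategy.run_stop {n : ℕ} (k : ℕ) :
    Strategy.run (fun _ => none : Strategy n) k = PMF.pure [] := by
  induction k with
  | zero => rfl
  | succ k ih => simp [Strategy.run, ih, Strategy.step]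

theorem Strategy.hasOutcome_stop {n : ℕ} :
    Strategy.HasOutcome (fun _ => none : Strategy n) (Lottery.null n) := by
  refine ⟨fun S => ?_, ?_⟩
  · simp only [Strategy.run_stop, PMF.pure_map]
    exact tendsto_const_nhds
  · simp [Strategy.cost, Strategy.nextPrice, Lottery.null]

/-- The buy-many mechanism generated by a set `L` of lotteries, in the form of a menu: its options
are the outcomes of all adaptive strategies of purchasing lotteries from `L`. -/
def Mechanism.buyMany {n : ℕ} (L : Set (Lottery n)) : Mechanism n where
  menu := {l | ∃ A : Strategy n, A.Uses L ∧ A.HasOutcome l}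
  null_mem := ⟨fun _ => none, fun _ _ h => by simp at h, Strategy.hasOutcome_stop⟩

/-- The optimal buy-many revenue for `D`. -/
def buyManyRev {n : ℕ} (D : PMF (BuyerValuation n)) : ℝ≥0∞ :=
  ⨆ (L : Set (Lottery n)) (_ : (Mechanism.buyMany L).WellPosed D),
    (Mechanism.buyMany L).revenue D

end

/-! With n about 256^K, a Reed–Solomon code gives many sets `C x` of common size q and small
pairwise intersections; a second code, on the indices x, gives N families `X i` (N doubly
exponential) that are nearly disjoint. The coverage valuation of `X i`, scaled to total value 2^a
with a < K, has expected value at most 1 for a random set of another family (`exists_design`).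

Sell to each i a uniformly random set of its own family at its full value 2^a ≥ 1. No type gains
from a foreign lottery, and by subadditivity no adaptive combination helps either
(`Strategy.utility_nonpos`). So buy-many extracts all the welfare, whatever the scales.

Draw the scale of each i independently with P(2^j) roughly 2^(-j). The mean welfare is of order K,
hence of order log n, while a fixed mechanism earns at most 4 in expectation from each i
(`Mechanism.sum_payment_div_le`). Payments lie in [0, 2^K], so a Chernoff bound fails with
probability exp(-8N/2^K), which beats the number of descriptions of at most N/2^K bits. Hence one
choice of scales defeats all of them (`exists_selection`). -/

/-! ### Set systems with small intersections -/

/-- Reed–Solomon codes: many sets of size `2 ^ k` with pairwise small intersections. -/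
theorem exists_finsets_card_inter_le {α : Type*} [Fintype α] [DecidableEq α] {k : ℕ} (hk : k ≠ 0)
    (d : ℕ) (hα : 2 ^ k * 2 ^ k ≤ Fintype.card α) :
    ∃ C : Fin ((2 ^ k) ^ d) → Finset α, (∀ x, (C x).card = 2 ^ k) ∧
      ∀ x y, x ≠ y → (C x ∩ C y).card ≤ d := by
  classical
  let F := GaloisField 2 k
  have : Fintype F := Fintype.ofFinite F
  have hF : Fintype.card F = 2 ^ k := by
    rw [← Nat.card_eq_fintype_card]; exact GaloisField.card 2 k hk
  obtain ⟨e⟩ : Nonempty (F × F ↪ α) := by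
    apply Function.Embedding.nonempty_of_card_le
    rw [Fintype.card_prod, hF]; exact hα
  have hX : Fintype.card (Fin ((2 ^ k) ^ d)) = Fintype.card (Fin d → F) := by
    simp [hF]
  let φ := Fintype.equivOfCardEq hX
  let ev : (Fin d → F) → F → F := fun a t => ∑ i : Fin d, a i * t ^ (i : ℕ)
  -- The sets are graphs of polynomials of degree below d, placed in α through `e`.
  let g : (Fin d → F) → F ↪ α := fun a =>
    ⟨fun t => e (t, ev a t), fun s t h => by
      have := e.injective h
      exact (Prod.ext_iff.1 this).1⟩
  refine ⟨fun x => Finset.univ.map (g (φ x)), fun x => by simp [hF], fun x y hxy => ?_⟩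
  set a := φ x
  set b := φ y
  have hab : a ≠ b := fun h => hxy (φ.injective h)
  let P : Polynomial F := ∑ i : Fin d, Polynomial.C (a i - b i) * Polynomial.X ^ (i : ℕ)
  have hcoef : ∀ i : Fin d, P.coeff i = a i - b i := by
    intro i
    simp only [P, Polynomial.finsetSum_coeff, Polynomial.coeff_C_mul, Polynomial.coeff_X_pow]
    simp [Fin.val_inj]
  have hP : P ≠ 0 := by
    intro h
    apply hab
    funext i
    have := hcoef i
    rw [h, Polynomial.coeff_zero] at this
    exact (sub_eq_zero.1 this.symm)
  have hdeg : P.natDegree ≤ d := by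
    apply Polynomial.natDegree_sum_le_of_forall_le
    intro i _
    exact (Polynomial.natDegree_C_mul_X_pow_le _ _).trans i.2.le
  -- A common point of two graphs has a single abscissa, which is a root of the difference `P`.
  have hsub : Finset.univ.map (g a) ∩ Finset.univ.map (g b) ⊆ P.roots.toFinset.map (g a) := by
    intro z hz
    simp only [Finset.mem_inter, Finset.mem_map, Finset.mem_univ, true_and] at hz
    obtain ⟨⟨t, rfl⟩, s, hs⟩ := hz
    have h1 := Prod.ext_iff.1 (e.injective hs)
    obtain rfl : s = t := h1.1
    refine Finset.mem_map_of_mem _ ?_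
    rw [Multiset.mem_toFinset, Polynomial.mem_roots hP, Polynomial.IsRoot.def]
    have h2 : ev b s = ev a s := h1.2
    simp only [P, Polynomial.eval_finsetSum, Polynomial.eval_mul, Polynomial.eval_C,
      Polynomial.eval_pow, Polynomial.eval_X, sub_mul, Finset.sum_sub_distrib]
    exact sub_eq_zero.2 h2.symm
  calc _ ≤ (P.roots.toFinset.map (g a)).card := Finset.card_le_card hsub
    _ ≤ Multiset.card P.roots := by rw [Finset.card_map]; exact Multiset.toFinset_card_le _
    _ ≤ d := (Polynomial.card_roots' P).trans hdeg

/-! ### Concentration for independent selections -/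

/-- Under the product law the exponential moment factorises over the coordinates. -/
theorem sum_prod_mul_exp_sum_le {I J : Type*} [Fintype I] [DecidableEq I] [Fintype J]
    {μ : J → ℝ} (hμ : ∀ j, 0 ≤ μ j) (f : I → J → ℝ) (a : ℝ)
    (h : ∀ i, ∑ j, μ j * Real.exp (f i j) ≤ Real.exp a) :
    ∑ σ : I → J, (∏ i, μ (σ i)) * Real.exp (∑ i, f i (σ i)) ≤
      Real.exp (Fintype.card I * a) := by
  classical
  have h1 : ∑ σ : I → J, (∏ i, μ (σ i)) * Real.exp (∑ i, f i (σ i)) =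
      ∏ i, ∑ j, μ j * Real.exp (f i j) := by
    rw [Finset.prod_univ_sum, Fintype.piFinset_univ]
    refine Finset.sum_congr rfl fun σ _ => ?_
    rw [Real.exp_sum, Finset.prod_mul_distrib]
  rw [h1]
  calc _ ≤ ∏ _i : I, Real.exp a :=
        Finset.prod_le_prod (fun i _ => Finset.sum_nonneg fun j _ =>
          mul_nonneg (hμ j) (Real.exp_pos _).le) fun i _ => h i
    _ = _ := by rw [Finset.prod_const, Finset.card_univ, Real.exp_nat_mul]

theorem exp_le_one_add_two_mul {y : ℝ} (h0 : 0 ≤ y) (h1 : y ≤ 1) : Real.exp y ≤ 1 + 2 * y := by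
  have := Real.abs_exp_sub_one_sub_id_le (x := y) (by rw [abs_of_nonneg h0]; exact h1)
  have := (abs_le.1 this).2
  nlinarith

theorem exp_neg_le_one_sub_half {y : ℝ} (h0 : 0 ≤ y) (h1 : y ≤ 1) :
    Real.exp (-y) ≤ 1 - y / 2 := by
  have h2 : (1 + y)⁻¹ ≤ 1 - y / 2 := by
    rw [inv_le_iff_one_le_mul₀ (by linarith)]
    nlinarith
  refine le_trans ?_ h2
  rw [Real.exp_neg]
  exact inv_anti₀ (by linarith) (by linarith [Real.add_one_le_exp y])

/-- A union bound over exponential moments: some selection `σ` makes all the sums over `W`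
at most four times their maximal mean, and the sum of `s` at least a quarter of its mean. -/
theorem exists_selection {I J W : Type*} [Fintype I] [Fintype J] [Fintype W]
    {μ : J → ℝ} (hμ : ∀ j, 0 ≤ μ j) (hμ1 : ∑ j, μ j = 1) {H a m : ℝ} (hH : 0 < H)
    (X : W → I → J → ℝ) (hX0 : ∀ w i j, 0 ≤ X w i j) (hXH : ∀ w i j, X w i j ≤ H)
    (hXa : ∀ w i, ∑ j, μ j * X w i j ≤ a)
    (s : J → ℝ) (hs0 : ∀ j, 0 ≤ s j) (hsH : ∀ j, s j ≤ H) (hsm : m ≤ ∑ j, μ j * s j)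
    (hlt : (Fintype.card W : ℝ) * Real.exp (-(Fintype.card I * (2 * a / H))) +
      Real.exp (-(Fintype.card I * (m / (4 * H)))) < 1) :
    ∃ σ : I → J, (∀ w, ∑ i, X w i (σ i) ≤ Fintype.card I * (4 * a)) ∧
      Fintype.card I * (m / 4) ≤ ∑ i, s (σ i) := by
  classical
  set N : ℝ := (Fintype.card I : ℝ) with hN
  have hup : ∀ w, ∑ σ : I → J, (∏ i, μ (σ i)) *
      Real.exp (∑ i, X w i (σ i) / H) ≤ Real.exp (N * (2 * a / H)) := by
    intro w
    refine sum_prod_mul_exp_sum_le hμ (fun i j => X w i j / H) _ fun i => ?_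
    calc ∑ j, μ j * Real.exp (X w i j / H) ≤ ∑ j, (μ j + 2 / H * (μ j * X w i j)) := by
          refine Finset.sum_le_sum fun j _ => ?_
          have := exp_le_one_add_two_mul (div_nonneg (hX0 w i j) hH.le)
            ((div_le_one hH).2 (hXH w i j))
          calc _ ≤ μ j * (1 + 2 * (X w i j / H)) := mul_le_mul_of_nonneg_left this (hμ j)
            _ = _ := by ring
      _ = 1 + 2 / H * ∑ j, μ j * X w i j := by
          rw [Finset.sum_add_distrib, hμ1, Finset.mul_sum]
      _ ≤ 1 + 2 / H * a := by
          have := mul_le_mul_of_nonneg_left (hXa w i) (div_nonneg zero_le_two hH.le)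
          linarith
      _ ≤ _ := by
          rw [show 2 / H * a = 2 * a / H by ring, add_comm]; exact Real.add_one_le_exp _
  have hlo : ∑ σ : I → J, (∏ i, μ (σ i)) *
      Real.exp (∑ i, -(s (σ i) / H)) ≤ Real.exp (N * (-(m / (2 * H)))) := by
    refine sum_prod_mul_exp_sum_le hμ (fun _ j => -(s j / H)) _ fun i => ?_
    calc ∑ j, μ j * Real.exp (-(s j / H)) ≤ ∑ j, (μ j - 1 / (2 * H) * (μ j * s j)) := by
          refine Finset.sum_le_sum fun j _ => ?_
          have := exp_neg_le_one_sub_half (div_nonneg (hs0 j) hH.le)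
            ((div_le_one hH).2 (hsH j))
          calc _ ≤ μ j * (1 - s j / H / 2) := mul_le_mul_of_nonneg_left this (hμ j)
            _ = _ := by field_simp
      _ = 1 - 1 / (2 * H) * ∑ j, μ j * s j := by
          rw [Finset.sum_sub_distrib, hμ1, Finset.mul_sum]
      _ ≤ 1 - 1 / (2 * H) * m := by
          have := mul_le_mul_of_nonneg_left hsm (show 0 ≤ 1 / (2 * H) by positivity)
          linarith
      _ ≤ _ := by
          have := Real.add_one_le_exp (-(m / (2 * H)))
          rw [show 1 / (2 * H) * m = m / (2 * H) by ring]
          linarith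
  -- Each bad event makes one nonnegative summand of `E` at least 1. The thresholds 4a and m/4 are
  -- twice and half the exponential-moment rates 2a and m/2, which leaves the tails in `hlt`. Mean
  -- below 1 therefore yields a σ with no bad event.
  let E : (I → J) → ℝ := fun σ =>
    ∑ w, Real.exp (∑ i, X w i (σ i) / H) * Real.exp (-(N * (4 * a / H))) +
      Real.exp (∑ i, -(s (σ i) / H)) * Real.exp (N * (m / (4 * H)))
  have htot : ∑ σ : I → J, (∏ i, μ (σ i)) = 1 := by
    have := Finset.prod_univ_sum (fun _ : I => (Finset.univ : Finset J)) (fun _ j => μ j)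
    rw [Fintype.piFinset_univ] at this
    rw [← this]; simp [hμ1]
  have hE : ∑ σ : I → J, (∏ i, μ (σ i)) * E σ < 1 := by
    refine lt_of_le_of_lt ?_ hlt
    have : ∑ σ : I → J, (∏ i, μ (σ i)) * E σ =
        ∑ w, (∑ σ : I → J, (∏ i, μ (σ i)) * Real.exp (∑ i, X w i (σ i) / H)) *
          Real.exp (-(N * (4 * a / H))) +
        (∑ σ : I → J, (∏ i, μ (σ i)) * Real.exp (∑ i, -(s (σ i) / H))) *
          Real.exp (N * (m / (4 * H))) := by
      simp only [E, mul_add, Finset.sum_add_distrib, Finset.mul_sum, Finset.sum_mul]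
      rw [Finset.sum_comm]
      simp only [mul_assoc]
    rw [this]
    refine add_le_add ?_ ?_
    · calc _ ≤ ∑ _w : W, Real.exp (N * (2 * a / H)) * Real.exp (-(N * (4 * a / H))) :=
            Finset.sum_le_sum fun w _ => mul_le_mul_of_nonneg_right (hup w) (Real.exp_pos _).le
        _ = _ := by
            rw [Finset.sum_const, Finset.card_univ, nsmul_eq_mul, ← Real.exp_add]
            congr 2; ring
    · refine (mul_le_mul_of_nonneg_right hlo (Real.exp_pos _).le).trans (le_of_eq ?_)
      rw [← Real.exp_add]; congr 1; field_simp; ring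
  obtain ⟨σ, hσ⟩ : ∃ σ, E σ < 1 := by
    by_contra! hcon
    have : ∑ σ : I → J, (∏ i, μ (σ i)) ≤ ∑ σ : I → J, (∏ i, μ (σ i)) * E σ :=
      Finset.sum_le_sum fun σ _ =>
        le_mul_of_one_le_right (Finset.prod_nonneg fun i _ => hμ _) (hcon σ)
    linarith
  have hpos : ∀ w, 0 ≤ Real.exp (∑ i, X w i (σ i) / H) * Real.exp (-(N * (4 * a / H))) :=
    fun w => by positivity
  refine ⟨σ, fun w => ?_, ?_⟩
  · have h1 : Real.exp (∑ i, X w i (σ i) / H) * Real.exp (-(N * (4 * a / H))) < 1 := by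
      refine lt_of_le_of_lt ?_ hσ
      refine (Finset.single_le_sum (fun w _ => hpos w) (Finset.mem_univ w)).trans ?_
      exact le_add_of_nonneg_right (by positivity)
    rw [← Real.exp_add, Real.exp_lt_one_iff, ← Finset.sum_div] at h1
    have h2 : (∑ i, X w i (σ i)) / H < N * (4 * a) / H := by
      rw [mul_div_assoc]; linarith
    exact ((div_lt_div_iff_of_pos_right hH).1 h2).le
  · have h1 : Real.exp (∑ i, -(s (σ i) / H)) * Real.exp (N * (m / (4 * H))) < 1 := by
      refine lt_of_le_of_lt ?_ hσ
      exact le_add_of_nonneg_left (Finset.sum_nonneg fun w _ => hpos w)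
    rw [← Real.exp_add, Real.exp_lt_one_iff, Finset.sum_neg_distrib, ← Finset.sum_div] at h1
    have h2 : N * (m / 4) / H < (∑ i, s (σ i)) / H := by
      have : N * (m / 4) / H = N * (m / (4 * H)) := by field_simp
      linarith
    exact ((div_lt_div_iff_of_pos_right hH).1 h2).le

/-! ### Expectations with respect to a `PMF` -/

theorem PMF.tsum_bind_mul {α β : Type*} (p : PMF α) (q : α → PMF β) (f : β → ℝ≥0∞) :
    ∑' b, p.bind q b * f b = ∑' a, p a * ∑' b, q a b * f b := by
  simp only [PMF.bind_apply, ← ENNReal.tsum_mul_right, ← ENNReal.tsum_mul_left]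
  rw [ENNReal.tsum_comm]
  simp only [mul_assoc]

theorem PMF.tsum_pure_mul {α : Type*} (a : α) (f : α → ℝ≥0∞) :
    ∑' b, PMF.pure a b * f b = f a := by
  rw [tsum_eq_single a]
  · simp
  · intro b hb; simp [PMF.pure_apply_of_ne _ _ hb]

theorem PMF.tsum_map_mul {α β : Type*} (p : PMF α) (g : α → β) (f : β → ℝ≥0∞) :
    ∑' b, p.map g b * f b = ∑' a, p a * f (g a) := by
  rw [← PMF.bind_pure_comp, PMF.tsum_bind_mul]
  simp only [Function.comp_apply, PMF.tsum_pure_mul]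

theorem PMF.sum_map_mul {α β : Type*} [Fintype β] (p : PMF α) (g : α → β) (f : β → ℝ≥0∞) :
    ∑ b, p.map g b * f b = ∑' a, p a * f (g a) := by
  rw [← PMF.tsum_map_mul, tsum_fintype]

theorem PMF.toReal_sum_mul {β : Type*} [Fintype β] (p : PMF β) (f : β → ℝ≥0) :
    (∑ b, p b * (f b : ℝ≥0∞)).toReal = ∑ b, (p b).toReal * (f b : ℝ) := by
  rw [ENNReal.toReal_sum fun b _ => ENNReal.mul_ne_top (p.apply_ne_top b) ENNReal.coe_ne_top]
  simp

theorem PMF.sum_toReal {β : Type*} [Fintype β] (p : PMF β) : ∑ b, (p b).toReal = 1 := by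
  rw [← ENNReal.toReal_sum fun b _ => p.apply_ne_top b, ← tsum_fintype (L := .unconditional _),
    p.tsum_coe,
    ENNReal.toReal_one]

section

variable {n : ℕ}

theorem Mechanism.revenue_map_uniform {I : Type*} [Fintype I] [Nonempty I] (M : Mechanism n)
    (v : I → BuyerValuation n) :
    M.revenue ((PMF.uniformOfFintype I).map v) =
      (Fintype.card I : ℝ≥0∞)⁻¹ * ∑ i, M.payment (v i) := by
  rw [Mechanism.revenue, PMF.tsum_map_mul, tsum_fintype, Finset.mul_sum]
  simp only [PMF.uniformOfFintype_apply]

/-! ### Buy-many mechanisms -/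

/-- The strategy that buys the lottery `l` once. -/
noncomputable def Strategy.once (l : Lottery n) : Strategy n
  | [] => some l
  | _ :: _ => none

theorem Strategy.once_run_succ (l : Lottery n) (k : ℕ) :
    (Strategy.once l).run (k + 1) = l.alloc.map fun S => [S] := by
  induction k with
  | zero => simp [Strategy.run, Strategy.step, Strategy.once]
  | succ k ih =>
    rw [Strategy.run, ih, PMF.bind_map]
    rfl

theorem Strategy.once_hasOutcome (l : Lottery n) : (Strategy.once l).HasOutcome l := by
  refine ⟨fun S => ?_, ?_⟩
  -- The law of the acquired set is constant only from the first purchase on.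
  · rw [← tendsto_add_atTop_iff_nat 1]
    have : ∀ k, (((Strategy.once l).run (k + 1)).map acquired) S = l.alloc S := by
      intro k
      rw [Strategy.once_run_succ, PMF.map_comp]
      have : acquired ∘ (fun S : Finset (Fin n) => [S]) = id := by
        funext T; simp [acquired]
      rw [this, PMF.map_id]
    simp only [this]
    exact tendsto_const_nhds
  · rw [Strategy.cost, tsum_eq_single 0]
    · rw [Strategy.run, PMF.tsum_pure_mul]; rfl
    · intro k hk
      obtain ⟨k, rfl⟩ := Nat.exists_eq_succ_of_ne_zero hk
      rw [Nat.succ_eq_add_one, Strategy.once_run_succ, PMF.tsum_map_mul]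
      simp [Strategy.nextPrice, Strategy.once]

/-- If no single purchase has positive utility for a subadditive valuation, then the expected value
of what a strategy acquires is at most what it pays. -/
theorem Strategy.expected_value_le {v : BuyerValuation n} (hv0 : v.val ∅ = 0)
    (hv : ∀ S T, v.val (S ∪ T) ≤ v.val S + v.val T) {L : Set (Lottery n)}
    (hL : ∀ l ∈ L, ∑ S, l.alloc S * (v.val S : ℝ≥0∞) ≤ l.price) {A : Strategy n} (hA : A.Uses L)
    (k : ℕ) :
    ∑' h, A.run k h * (v.val (acquired h) : ℝ≥0∞) ≤
      ∑ j ∈ Finset.range k, ∑' h, A.run j h * (A.nextPrice h : ℝ≥0∞) := by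
  induction k with
  | zero => rw [Strategy.run, PMF.tsum_pure_mul]; simp [acquired, hv0]
  | succ k ih =>
    rw [Finset.sum_range_succ]
    refine le_trans ?_ (add_le_add_left ih _)
    rw [Strategy.run, PMF.tsum_bind_mul, ← ENNReal.tsum_add]
    refine ENNReal.tsum_le_tsum fun h => ?_
    rw [← mul_add]
    refine mul_le_mul_right ?_ _
    unfold Strategy.step Strategy.nextPrice
    cases hl : A h with
    | none => simp
    | some l =>
      simp only
      rw [PMF.tsum_map_mul]
      -- Given the history, the new set has law `l.alloc`; by subadditivity it adds at most its own
      -- expected value, hence at most its price.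
      calc ∑' S, l.alloc S * (v.val (acquired (S :: h)) : ℝ≥0∞)
          ≤ ∑' S, (l.alloc S * (v.val S : ℝ≥0∞) + l.alloc S * (v.val (acquired h) : ℝ≥0∞)) := by
            refine ENNReal.tsum_le_tsum fun S => ?_
            rw [← mul_add]
            refine mul_le_mul_right ?_ _
            exact_mod_cast hv S (acquired h)
        _ = ∑ S, l.alloc S * (v.val S : ℝ≥0∞) + v.val (acquired h) := by
            rw [ENNReal.tsum_add, ENNReal.tsum_mul_right, l.alloc.tsum_coe, one_mul, tsum_fintype]
        _ ≤ _ := by rw [add_comm]; exact add_le_add_right (hL l (hA h l hl)) _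

theorem Lottery.utility_nonpos_iff (v : BuyerValuation n) (l : Lottery n) :
    l.utility v ≤ 0 ↔ ∑ S, l.alloc S * (v.val S : ℝ≥0∞) ≤ l.price := by
  rw [Lottery.utility, ← PMF.toReal_sum_mul, sub_nonpos]
  rw [← ENNReal.coe_toReal, ENNReal.toReal_le_toReal _ ENNReal.coe_ne_top]
  exact ENNReal.sum_ne_top.2 fun b _ => ENNReal.mul_ne_top (PMF.apply_ne_top _ b) ENNReal.coe_ne_top

/-- The bound after k purchases passes to the limit, since there are finitely many sets and the
partial payments never exceed the total cost. -/
theorem Strategy.utility_nonpos {v : BuyerValuation n} (hv0 : v.val ∅ = 0)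
    (hv : ∀ S T, v.val (S ∪ T) ≤ v.val S + v.val T) {L : Set (Lottery n)}
    (hL : ∀ l ∈ L, l.utility v ≤ 0) {l : Lottery n} (hl : l ∈ (Mechanism.buyMany L).menu) :
    l.utility v ≤ 0 := by
  obtain ⟨A, hA, hlim, hcost⟩ := hl
  rw [Lottery.utility_nonpos_iff, ← hcost]
  have hlim' : Tendsto (fun k => ∑ S, ((A.run k).map acquired) S * (v.val S : ℝ≥0∞)) atTop
      (𝓝 (∑ S, l.alloc S * (v.val S : ℝ≥0∞))) := by
    refine tendsto_finsetSum _ fun S _ => ?_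
    exact ENNReal.Tendsto.mul_const (hlim S) (Or.inr ENNReal.coe_ne_top)
  refine le_of_tendsto' hlim' fun k => ?_
  rw [PMF.sum_map_mul]
  refine (Strategy.expected_value_le hv0 hv
    (fun l hl => (Lottery.utility_nonpos_iff v l).1 (hL l hl)) hA k).trans ?_
  exact ENNReal.sum_le_tsum _

/-- A lottery of zero utility is a best choice when no offered lottery has positive utility. -/
theorem Mechanism.buyMany_isBestChoice {v : BuyerValuation n} (hv0 : v.val ∅ = 0)
    (hv : ∀ S T, v.val (S ∪ T) ≤ v.val S + v.val T) {L : Set (Lottery n)}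
    (hL : ∀ l ∈ L, l.utility v ≤ 0) {l : Lottery n} (hl : l ∈ L) (hl0 : l.utility v = 0) :
    (Mechanism.buyMany L).IsBestChoice v l := by
  refine ⟨⟨Strategy.once l, ?_, Strategy.once_hasOutcome l⟩, fun l' hl' => ?_⟩
  · rintro (_ | ⟨S, h⟩) l' hl'
    · obtain rfl : l = l' := by simpa [Strategy.once] using hl'
      exact hl
    · simp [Strategy.once] at hl'
  · rw [hl0]; exact Strategy.utility_nonpos hv0 hv hL hl'

/-! ### Single-parameter screening -/

/-- Expected value of the allocation. -/
def Lottery.value (v : BuyerValuation n) (l : Lottery n) : ℝ :=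
  ∑ S : Finset (Fin n), (l.alloc S).toReal * (v.val S : ℝ)

theorem Lottery.value_le (v : BuyerValuation n) (l : Lottery n) :
    l.value v ≤ v.val Finset.univ := by
  calc l.value v ≤ ∑ S, (l.alloc S).toReal * (v.val Finset.univ : ℝ) :=
        Finset.sum_le_sum fun S _ => mul_le_mul_of_nonneg_left
          (by exact_mod_cast v.mono _ _ (Finset.subset_univ S)) ENNReal.toReal_nonneg
    _ = _ := by rw [← Finset.sum_mul, PMF.sum_toReal, one_mul]

theorem Lottery.utility_null_nonneg (v : BuyerValuation n) : 0 ≤ (Lottery.null n).utility v := by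
  simp only [Lottery.utility, Lottery.null, NNReal.coe_zero, sub_zero]
  exact Finset.sum_nonneg fun S _ => mul_nonneg ENNReal.toReal_nonneg (NNReal.coe_nonneg _)

theorem Mechanism.IsBestChoice.price_le {M : Mechanism n} {v : BuyerValuation n} {l : Lottery n}
    (h : M.IsBestChoice v l) : l.price ≤ v.val Finset.univ := by
  have h1 := (Lottery.utility_null_nonneg v).trans (h.2 _ M.null_mem)
  have h2 := l.value_le v
  have h3 : l.utility v = l.value v - l.price := rfl
  exact_mod_cast (show (l.price : ℝ) ≤ v.val Finset.univ by linarith)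

theorem Mechanism.payment_le (M : Mechanism n) (v : BuyerValuation n) :
    M.payment v ≤ v.val Finset.univ :=
  iSup₂_le fun _ h => ENNReal.coe_le_coe.2 h.price_le

theorem Mechanism.payment_ne_top (M : Mechanism n) (v : BuyerValuation n) : M.payment v ≠ ∞ :=
  ne_top_of_le_ne_top ENNReal.coe_ne_top (M.payment_le v)

/-- The supremum over best choices need not be attained, and there may be no best choice at all; a
factor 2 buys an actual lottery. -/
theorem Mechanism.payment_eq_zero_or (M : Mechanism n) (v : BuyerValuation n) :
    M.payment v = 0 ∨ ∃ l, M.IsBestChoice v l ∧ (M.payment v).toReal ≤ 2 * l.price := by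
  by_cases h0 : M.payment v = 0
  · exact Or.inl h0
  right
  have hlt : M.payment v / 2 < M.payment v := ENNReal.half_lt_self h0 (M.payment_ne_top v)
  nth_rw 2 [Mechanism.payment] at hlt
  simp only [lt_iSup_iff] at hlt
  obtain ⟨l, hl, h⟩ := hlt
  refine ⟨l, hl, ?_⟩
  have h' := (ENNReal.toReal_le_toReal
    (ENNReal.div_ne_top (M.payment_ne_top v) two_ne_zero) ENNReal.coe_ne_top).2 h.le
  rw [ENNReal.toReal_div] at h'
  simp only [ENNReal.toReal_ofNat, ENNReal.coe_toReal] at h'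
  linarith

/-- Against the equal-revenue scale of multiples `2 ^ j` of one valuation, the payments discounted
by `2 ^ j` have bounded sum. -/
theorem Mechanism.sum_payment_div_le (M : Mechanism n) (w : BuyerValuation n)
    (hw : w.val Finset.univ ≤ 1) (v : ℕ → BuyerValuation n)
    (hv : ∀ j S, (v j).val S = 2 ^ j * w.val S) (K : ℕ) :
    ∑ j ∈ Finset.range K, (M.payment (v j)).toReal / 2 ^ j ≤ 4 := by
  have hutil : ∀ j (l : Lottery n), l.utility (v j) = 2 ^ j * l.value w - l.price := by
    intro j l
    simp only [Lottery.utility, Lottery.value, hv, Finset.mul_sum]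
    congr 1
    refine Finset.sum_congr rfl fun S _ => ?_
    push_cast; ring
  -- The incentive constraint of type k against the previous witness makes the invariant telescope.
  -- Of the factor 4, one 2 pays for non-attainment and the other for the halving of 1/2^k.
  have key : ∀ k, ∃ l ∈ M.menu, ∑ j ∈ Finset.range k, (M.payment (v j)).toReal / 2 ^ j +
      4 * l.price / 2 ^ k ≤ 4 * l.value w := by
    intro k
    induction k with
    | zero =>
      refine ⟨_, M.null_mem, ?_⟩
      have := Lottery.utility_null_nonneg w
      have h3 : (Lottery.null n).utility w = (Lottery.null n).value w - (Lottery.null n).price := rfl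
      have h4 : ((Lottery.null n).price : ℝ) = 0 := rfl
      rw [h3, h4] at this
      simp only [Finset.range_zero, Finset.sum_empty, h4]
      linarith
    | succ k ih =>
      obtain ⟨l, hl, h⟩ := ih
      rcases M.payment_eq_zero_or (v k) with h0 | ⟨l', hl', h'⟩
      · refine ⟨l, hl, le_trans ?_ h⟩
        rw [Finset.sum_range_succ, h0]
        have : (4 * l.price / 2 ^ (k + 1) : ℝ) ≤ 4 * l.price / 2 ^ k := by
          gcongr <;> norm_num
        simpa using this
      · refine ⟨l', hl'.1, ?_⟩
        have hic := hl'.2 l hl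
        rw [hutil, hutil] at hic
        rw [Finset.sum_range_succ]
        have h1 : (M.payment (v k)).toReal / 2 ^ k ≤ 2 * l'.price / 2 ^ k := by gcongr
        have h2 : (4 * l'.price / 2 ^ (k + 1) : ℝ) = 2 * l'.price / 2 ^ k := by
          field_simp; ring
        have h3 : (l'.price : ℝ) / 2 ^ k ≤ l'.value w - l.value w + l.price / 2 ^ k := by
          rw [div_le_iff₀ (by positivity)]
          have : (l.price : ℝ) / 2 ^ k * 2 ^ k = l.price := by field_simp
          rw [add_mul, this]; linarith
        have h4 : (2 * l'.price / 2 ^ k : ℝ) = 2 * (l'.price / 2 ^ k) := by ring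
        have h5 : (4 * l.price / 2 ^ k : ℝ) = 4 * (l.price / 2 ^ k) := by ring
        linarith
  obtain ⟨l, -, h⟩ := key K
  have h1 := l.value_le w
  have h2 : (w.val Finset.univ : ℝ) ≤ 1 := by exact_mod_cast hw
  have h3 : (0 : ℝ) ≤ 4 * l.price / 2 ^ K := by positivity
  linarith

/-! ### Coverage valuations of set families -/

/-- The valuation `S ↦ c * max_{x ∈ X} |S ∩ C x|`. -/
def BuyerValuation.coverage {ι : Type*} (C : ι → Finset (Fin n)) (X : Finset ι) (c : ℝ≥0) :
    BuyerValuation n where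
  val S := X.sup fun x => c * (S ∩ C x).card
  mono S T h := Finset.sup_mono_fun fun x _ => by gcongr

theorem BuyerValuation.coverage_val {ι : Type*} (C : ι → Finset (Fin n)) (X : Finset ι) (c : ℝ≥0)
    (S : Finset (Fin n)) :
    (BuyerValuation.coverage C X c).val S = X.sup fun x => c * ((S ∩ C x).card : ℝ≥0) := rfl

theorem BuyerValuation.coverage_isXOS {ι : Type*} (C : ι → Finset (Fin n)) (X : Finset ι)
    (c : ℝ≥0) : (BuyerValuation.coverage C X c).IsXOS := by
  classical
  refine ⟨X.image fun x i => if i ∈ C x then c else 0, fun S => ?_⟩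
  rw [Finset.sup_image, BuyerValuation.coverage_val]
  refine Finset.sup_congr rfl fun x _ => ?_
  simp [Finset.sum_ite_mem, mul_comm]

theorem BuyerValuation.coverage_empty {ι : Type*} (C : ι → Finset (Fin n)) (X : Finset ι)
    (c : ℝ≥0) : (BuyerValuation.coverage C X c).val ∅ = 0 := by
  rw [BuyerValuation.coverage_val, ← nonpos_iff_eq_zero]
  exact Finset.sup_le fun x _ => by simp

/-- The clause that is best on the union is itself subadditive and is dominated by the maximum on
each part. -/
theorem BuyerValuation.coverage_union_le {ι : Type*} (C : ι → Finset (Fin n)) (X : Finset ι)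
    (c : ℝ≥0) (S T : Finset (Fin n)) :
    (BuyerValuation.coverage C X c).val (S ∪ T) ≤
      (BuyerValuation.coverage C X c).val S + (BuyerValuation.coverage C X c).val T := by
  simp only [BuyerValuation.coverage_val]
  refine Finset.sup_le fun x hx => ?_
  refine le_trans ?_ (add_le_add
    (Finset.le_sup (f := fun x => c * ((S ∩ C x).card : ℝ≥0)) hx)
    (Finset.le_sup (f := fun x => c * ((T ∩ C x).card : ℝ≥0)) hx))
  rw [← mul_add, Finset.union_inter_distrib_right]
  gcongr
  exact_mod_cast Finset.card_union_le _ _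

theorem BuyerValuation.coverage_eq_of_subset {ι : Type*} {C : ι → Finset (Fin n)} {X : Finset ι}
    {q : ℕ} (hC : ∀ x, (C x).card = q) (c : ℝ≥0) {x : ι} (hx : x ∈ X) {S : Finset (Fin n)}
    (hS : C x ⊆ S) : (BuyerValuation.coverage C X c).val S = c * q := by
  rw [BuyerValuation.coverage_val]
  apply le_antisymm
  · refine Finset.sup_le fun y _ => ?_
    gcongr
    exact_mod_cast (Finset.card_le_card Finset.inter_subset_right).trans (hC y).le
  · refine le_trans ?_ (Finset.le_sup hx)
    rw [Finset.inter_eq_right.2 hS, hC]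

/-- The lottery that awards `C x` for uniformly random `x ∈ X`. -/
noncomputable def Lottery.uniform {ι : Type*} (C : ι → Finset (Fin n)) (X : Finset ι) (hX : X.Nonempty)
    (p : ℝ≥0) : Lottery n := ⟨(PMF.uniformOfFinset X hX).map C, p⟩

theorem Lottery.uniform_utility {ι : Type*} (C : ι → Finset (Fin n)) (X : Finset ι)
    (hX : X.Nonempty) (p : ℝ≥0) (v : BuyerValuation n) :
    (Lottery.uniform C X hX p).utility v = (∑ x ∈ X, (v.val (C x) : ℝ)) / X.card - p := by
  rw [Lottery.utility, Lottery.uniform, ← PMF.toReal_sum_mul, PMF.sum_map_mul]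
  congr 1
  rw [tsum_eq_sum (s := X) (fun x hx => by simp [hx])]
  rw [Finset.sum_congr rfl (g := fun x => (X.card : ℝ≥0∞)⁻¹ * (v.val (C x) : ℝ≥0∞))
    (fun x hx => by rw [PMF.uniformOfFinset_apply_of_mem hX hx]), ← Finset.mul_sum]
  rw [ENNReal.toReal_mul, ENNReal.toReal_sum (fun _ _ => ENNReal.coe_ne_top)]
  simp [div_eq_inv_mul]

/-- A type whose family is nearly disjoint from the offered one values the lottery little. -/
theorem Lottery.uniform_value_le {ι : Type*} [DecidableEq ι] {C : ι → Finset (Fin n)} {q d D : ℕ}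
    (hC : ∀ x, (C x).card = q) (hCd : ∀ x y, x ≠ y → (C x ∩ C y).card ≤ d) (X Y : Finset ι)
    (hXY : (Y ∩ X).card ≤ D) (c : ℝ≥0) :
    ∑ y ∈ Y, ((BuyerValuation.coverage C X c).val (C y) : ℝ) ≤ c * q * D + c * d * Y.card := by
  -- Shared indices, at most D of them, count in full; any other `C y` meets every `C x` with x ∈ X
  -- in at most d points.
  have h1 : ∀ y ∈ Y, ((BuyerValuation.coverage C X c).val (C y) : ℝ) ≤
      (if y ∈ X then (c * q : ℝ) else 0) + c * d := by
    intro y _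
    have hcd : (0 : ℝ) ≤ c * d := by positivity
    split_ifs with hy
    · rw [BuyerValuation.coverage_eq_of_subset hC c hy subset_rfl]
      push_cast; linarith
    · rw [zero_add]
      have : (BuyerValuation.coverage C X c).val (C y) ≤ c * d := by
        rw [BuyerValuation.coverage_val]
        refine Finset.sup_le fun x hx => ?_
        gcongr
        exact_mod_cast hCd y x (fun h => hy (h ▸ hx))
      exact_mod_cast this
  refine (Finset.sum_le_sum h1).trans ?_
  rw [Finset.sum_add_distrib, ← Finset.sum_filter, Finset.filter_mem_eq_inter, Finset.sum_const,
    Finset.sum_const, nsmul_eq_mul, nsmul_eq_mul]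
  have : ((Y ∩ X).card : ℝ) ≤ D := by exact_mod_cast hXY
  have h2 := mul_le_mul_of_nonneg_left this (show (0 : ℝ) ≤ c * q by positivity)
  linarith

end

/-! ### The design -/

/-- Doubly exponentially many families of sets, such that every coverage valuation of one family,
of total value `2 ^ a`, gives expected value at most `1` to a random set of another family. -/
theorem exists_design {n K : ℕ} (hK : K ≠ 0) (hn : 256 ^ K ≤ n) :
    ∃ (ι : Type) (C : ι → Finset (Fin n))
      (X : Fin ((2 ^ (2 * K * 4 ^ K)) ^ 2 ^ (2 * K * 4 ^ K - K - 1)) → Finset ι),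
      (∀ x, (C x).card = 2 ^ (4 * K)) ∧ (∀ i, (X i).Nonempty) ∧
      ∀ i j, i ≠ j → ∀ a < K, ∑ y ∈ X j,
        ((BuyerValuation.coverage C (X i) (2 ^ a / 2 ^ (4 * K))).val (C y) : ℝ) ≤ (X j).card := by
  have hexp : K + 1 ≤ 2 * K * 4 ^ K := by
    have : 1 ≤ 4 ^ K := Nat.one_le_pow _ _ (by norm_num)
    have : 2 * K * 1 ≤ 2 * K * 4 ^ K := Nat.mul_le_mul_left _ this
    omega
  -- Here q = 2^(4K), so q² = 256^K fits into n, and intersections are at most 4^K = q/4^K.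
  obtain ⟨C, hC, hCd⟩ := exists_finsets_card_inter_le (α := Fin n) (k := 4 * K)
    (by omega) (4 ^ K) (by
      rw [Fintype.card_fin, ← pow_add, show 4 * K + 4 * K = 8 * K by ring, pow_mul]
      exact hn)
  -- The family size Q = 2^(2K·4^K) is the square root of the number of indices; families share at
  -- most D = Q/2^(K+1) of them.
  obtain ⟨X, hX, hXd⟩ := exists_finsets_card_inter_le (α := Fin ((2 ^ (4 * K)) ^ 4 ^ K))
    (k := 2 * K * 4 ^ K) (by omega) (2 ^ (2 * K * 4 ^ K - K - 1)) (by
      rw [Fintype.card_fin, ← pow_add, ← pow_mul]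
      exact le_of_eq (by congr 1; ring))
  refine ⟨_, C, X, hC, fun i => ?_, fun i j hij a ha => ?_⟩
  · rw [← Finset.card_pos, hX]; positivity
  · refine (Lottery.uniform_value_le hC hCd (X i) (X j) (hXd j i hij.symm) _).trans ?_
    rw [hX]
    push_cast
    set D : ℝ := (2 : ℝ) ^ (2 * K * 4 ^ K - K - 1) with hD
    have hQ : (2 : ℝ) ^ (2 * K * 4 ^ K) = D * 2 ^ (K + 1) := by
      rw [hD, ← pow_add]; congr 1; omega
    rw [hQ]
    have h16 : (2 : ℝ) ^ (4 * K) = 4 ^ K * (2 ^ K * 2 ^ K) := by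
      rw [pow_mul, ← mul_pow, ← mul_pow]; norm_num
    have hD0 : 0 < D := by positivity
    have ha' : 2 * (2 : ℝ) ^ a ≤ 2 ^ K := by
      rw [← pow_succ']; exact pow_le_pow_right₀ (by norm_num) ha
    have h2K : (2 : ℝ) ≤ 2 ^ K := by
      calc (2 : ℝ) = 2 ^ 1 := by norm_num
        _ ≤ 2 ^ K := pow_le_pow_right₀ (by norm_num) (by omega)
    -- The contributions of shared and of foreign indices; with a < K each is at most a quarter of
    -- Q, so the estimates below have room to spare.
    have e1 : (2 : ℝ) ^ a / 2 ^ (4 * K) * 2 ^ (4 * K) * D = 2 ^ a * D := by field_simp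
    have e2 : (2 : ℝ) ^ a / 2 ^ (4 * K) * 4 ^ K * (D * 2 ^ (K + 1)) = 2 * 2 ^ a / 2 ^ K * D := by
      rw [h16, pow_succ]; field_simp
    rw [e1, e2, pow_succ]
    have h3 : 2 * (2 : ℝ) ^ a / 2 ^ K ≤ 1 := (div_le_one (by positivity)).2 ha'
    have h4 : 2 * (2 : ℝ) ^ a / 2 ^ K * D ≤ 1 * D := mul_le_mul_of_nonneg_right h3 hD0.le
    have h5 : (2 : ℝ) ^ a * D ≤ 2 ^ K * D := by
      refine mul_le_mul_of_nonneg_right ?_ hD0.le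
      linarith [show (0 : ℝ) < 2 ^ a by positivity]
    have h6 : 2 * D ≤ 2 ^ K * D := mul_le_mul_of_nonneg_right h2K hD0.le
    linarith

/-- If each type exactly breaks even on its own lottery and no type gains from any lottery,
buy-many extracts the average price. -/
theorem le_buyManyRev {n : ℕ} {I : Type*} [Fintype I] [Nonempty I] (v : I → BuyerValuation n)
    (l : I → Lottery n) (hv0 : ∀ i, (v i).val ∅ = 0)
    (hv : ∀ i S T, (v i).val (S ∪ T) ≤ (v i).val S + (v i).val T)
    (hl : ∀ i, (l i).utility (v i) = 0) (hl' : ∀ i j, (l j).utility (v i) ≤ 0) :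
    (Fintype.card I : ℝ≥0∞)⁻¹ * ∑ i, ((l i).price : ℝ≥0∞) ≤
      buyManyRev ((PMF.uniformOfFintype I).map v) := by
  have hbest : ∀ i, (Mechanism.buyMany (Set.range l)).IsBestChoice (v i) (l i) := fun i =>
    Mechanism.buyMany_isBestChoice (hv0 i) (hv i) (by rintro _ ⟨j, rfl⟩; exact hl' i j) ⟨i, rfl⟩
      (hl i)
  refine le_trans ?_ (le_iSup₂ (f := fun (L : Set (Lottery n))
    (_ : (Mechanism.buyMany L).WellPosed ((PMF.uniformOfFintype I).map v)) =>
      (Mechanism.buyMany L).revenue ((PMF.uniformOfFintype I).map v)) (Set.range l) ?_)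
  · rw [Mechanism.revenue_map_uniform]
    gcongr with i
    exact le_iSup₂ (f := fun (l' : Lottery n)
      (_ : (Mechanism.buyMany (Set.range l)).IsBestChoice (v i) l') => (l'.price : ℝ≥0∞)) _ (hbest i)
  · intro w hw
    obtain ⟨i, -, rfl⟩ := (PMF.mem_support_map_iff _ _ _).1 hw
    exact ⟨_, hbest i⟩

/-! ### Numerical estimates -/

/-- The doubly exponential bound in terms of the size of the design. -/
theorem doublyExp_bound_le {n K : ℕ} (hK : K ≠ 0) (hn : 256 ^ K ≤ n) (hn' : n < 256 ^ (K + 1)) :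
    1 / Real.sqrt (n : ℝ) * (2 : ℝ) ^ ((2 : ℝ) ^ ((n : ℝ) ^ (1 / 4 : ℝ) / 4)) ≤
      (((2 ^ (2 * K * 4 ^ K)) ^ 2 ^ (2 * K * 4 ^ K - K - 1) : ℕ) : ℝ) / 2 ^ K := by
  have h1 : (n : ℝ) ^ (1 / 4 : ℝ) / 4 ≤ (4 ^ K : ℕ) := by
    have h : (n : ℝ) ≤ (4 ^ (K + 1) : ℝ) ^ 4 := by
      rw [← pow_mul, mul_comm, pow_mul]; norm_num; exact_mod_cast hn'.le
    have h2 : (n : ℝ) ^ (1 / 4 : ℝ) ≤ ((4 ^ (K + 1) : ℝ) ^ 4) ^ (1 / 4 : ℝ) :=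
      Real.rpow_le_rpow (Nat.cast_nonneg _) h (by norm_num)
    have h3 : ((4 ^ (K + 1) : ℝ) ^ 4) ^ (1 / 4 : ℝ) = 4 ^ (K + 1) := by
      have := Real.pow_rpow_inv_natCast (x := (4 ^ (K + 1) : ℝ)) (by positivity)
        (show (4 : ℕ) ≠ 0 by norm_num)
      rw [show (1 / 4 : ℝ) = ((4 : ℕ) : ℝ)⁻¹ by norm_num]; exact this
    rw [h3, pow_succ] at h2
    push_cast
    linarith
  have h2 : (2 : ℝ) ^ ((n : ℝ) ^ (1 / 4 : ℝ) / 4) ≤ ((2 ^ (4 ^ K) : ℕ) : ℝ) := by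
    refine (Real.rpow_le_rpow_of_exponent_le (by norm_num) h1).trans (le_of_eq ?_)
    rw [Real.rpow_natCast]; push_cast; rfl
  have h3 : (2 : ℝ) ^ ((2 : ℝ) ^ ((n : ℝ) ^ (1 / 4 : ℝ) / 4)) ≤ ((2 ^ 2 ^ 4 ^ K : ℕ) : ℝ) := by
    refine (Real.rpow_le_rpow_of_exponent_le (by norm_num) h2).trans (le_of_eq ?_)
    rw [Real.rpow_natCast]; push_cast; rfl
  -- This compares the inner exponents: n^(1/4)/4 is at most 4^K, which the exponent of D dominates.
  have h4 : 4 ^ K ≤ 2 * K * 4 ^ K - K - 1 := by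
    have h : 4 ≤ 4 ^ K := Nat.le_self_pow hK 4
    have h5 : K * 4 ≤ K * 4 ^ K := Nat.mul_le_mul_left _ h
    have h6 : 1 * 4 ^ K ≤ K * 4 ^ K := Nat.mul_le_mul_right _ (by omega)
    rw [mul_assoc]
    omega
  have h5 : 2 ^ 2 ^ 4 ^ K ≤ (2 ^ (2 * K * 4 ^ K)) ^ 2 ^ (2 * K * 4 ^ K - K - 1) := by
    calc 2 ^ 2 ^ 4 ^ K ≤ 2 ^ 2 ^ (2 * K * 4 ^ K - K - 1) :=
          Nat.pow_le_pow_right (by norm_num) (Nat.pow_le_pow_right (by norm_num) h4)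
      _ ≤ _ := Nat.pow_le_pow_left (Nat.le_self_pow (by positivity) 2) _
  have h6 : (2 : ℝ) ^ K ≤ Real.sqrt n := by
    apply Real.le_sqrt_of_sq_le
    calc ((2 : ℝ) ^ K) ^ 2 = 4 ^ K := by rw [← pow_mul, mul_comm, pow_mul]; norm_num
      _ ≤ 256 ^ K := pow_le_pow_left₀ (by norm_num) (by norm_num) _
      _ ≤ n := by exact_mod_cast hn
  calc _ ≤ 1 / (2 : ℝ) ^ K *
        (((2 ^ (2 * K * 4 ^ K)) ^ 2 ^ (2 * K * 4 ^ K - K - 1) : ℕ) : ℝ) := by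
        refine mul_le_mul (one_div_le_one_div_of_le (by positivity) h6)
          (h3.trans (by exact_mod_cast h5)) (by positivity) (by positivity)
    _ = _ := by ring

/-- The constant 16 makes both failure terms in the final union bound at most 1/e, so that their sum
is below 1. -/
theorem sixteen_le_design_size {K : ℕ} (hK : K ≠ 0) :
    (16 : ℝ) ≤ (((2 ^ (2 * K * 4 ^ K)) ^ 2 ^ (2 * K * 4 ^ K - K - 1) : ℕ) : ℝ) / 2 ^ K := by
  rw [le_div_iff₀ (by positivity)]
  have h : K + 4 ≤ 2 * K * 4 ^ K := by
    have h : 4 ≤ 4 ^ K := Nat.le_self_pow hK 4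
    have h5 : 2 * K * 4 ≤ 2 * K * 4 ^ K := Nat.mul_le_mul_left _ h
    omega
  have : 16 * 2 ^ K ≤ (2 ^ (2 * K * 4 ^ K)) ^ 2 ^ (2 * K * 4 ^ K - K - 1) := by
    calc 16 * 2 ^ K = 2 ^ (K + 4) := by ring
      _ ≤ 2 ^ (2 * K * 4 ^ K) := Nat.pow_le_pow_right (by norm_num) h
      _ ≤ _ := Nat.le_self_pow (by positivity) _
  exact_mod_cast this

/-- Base e in place of 2 lets the count multiply directly with the Chernoff tail. -/
theorem card_words_le (b : ℕ) :
    (Fintype.card (Σ k : Fin (b + 1), (Fin k → Bool)) : ℝ) ≤ Real.exp (b + 1) := by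
  have h1 : Fintype.card (Σ k : Fin (b + 1), (Fin k → Bool)) ≤ 2 ^ (b + 1) := by
    simp only [Fintype.card_sigma, Fintype.card_fun, Fintype.card_bool, Fintype.card_fin]
    rw [Fin.sum_univ_eq_sum_range (fun k => 2 ^ k) (b + 1)]
    exact (Nat.geomSum_lt le_rfl fun k hk => Finset.mem_range.1 hk).le
  calc _ ≤ (2 : ℝ) ^ (b + 1) := by exact_mod_cast h1
    _ ≤ Real.exp 1 ^ (b + 1) :=
        pow_le_pow_left₀ (by norm_num) (by linarith [Real.exp_one_gt_d9]) _
    _ = _ := by rw [← Real.exp_nat_mul]; push_cast; rw [mul_one]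

/-- The truncated geometric distribution on `Fin K`. -/
theorem exists_geometric_weights {K : ℕ} (hK : K ≠ 0) :
    ∃ μ : Fin K → ℝ, (∀ j, 0 ≤ μ j) ∧ (∀ j, μ j ≤ 1 / 2 ^ (j : ℕ)) ∧ ∑ j, μ j = 1 ∧
      (K : ℝ) / 2 ≤ ∑ j, μ j * 2 ^ (j : ℕ) := by
  set Z : ℝ := ∑ j : Fin K, 1 / 2 ^ (j : ℕ) with hZ
  have hZ2 : Z ≤ 2 := by
    rw [hZ, Fin.sum_univ_eq_sum_range (fun j => (1 : ℝ) / 2 ^ j) K]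
    simpa using sum_geometric_two_le K
  have hZ1 : 1 ≤ Z := by
    have := Finset.single_le_sum (f := fun j : Fin K => (1 : ℝ) / 2 ^ (j : ℕ))
      (fun j _ => by positivity) (Finset.mem_univ ⟨0, Nat.pos_of_ne_zero hK⟩)
    rw [hZ]; simpa using this
  have hZ0 : 0 < Z := by linarith
  refine ⟨fun j => 1 / 2 ^ (j : ℕ) / Z, fun j => by positivity,
    fun j => div_le_self (by positivity) hZ1, ?_, ?_⟩
  · rw [← Finset.sum_div, ← hZ, div_self hZ0.ne']
  · have : ∀ j : Fin K, (1 : ℝ) / 2 ^ (j : ℕ) / Z * 2 ^ (j : ℕ) = 1 / Z := fun j => by field_simp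
    simp only [this, Finset.sum_const, Finset.card_univ, Fintype.card_fin, nsmul_eq_mul]
    rw [mul_one_div]
    exact div_le_div_of_nonneg_left (Nat.cast_nonneg _) hZ0 hZ2

theorem log_le_of_lt_pow {n K : ℕ} (hK : K ≠ 0) (hn0 : n ≠ 0) (hn' : n < 256 ^ (K + 1)) :
    Real.log n ≤ 12 * K := by
  have h : Real.log n ≤ Real.log ((2 : ℝ) ^ (8 * (K + 1))) := by
    apply Real.log_le_log (by positivity)
    rw [pow_mul]; norm_num; exact_mod_cast hn'.le
  rw [Real.log_pow] at h
  push_cast at h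
  have hK1 : (1 : ℝ) ≤ K := by exact_mod_cast Nat.one_le_iff_ne_zero.2 hK
  nlinarith [Real.log_two_lt_d9]

/-! ### The lower bound -/

theorem mainTheorem4 :
    ∃ c δ : ℝ, 0 < c ∧ 0 < δ ∧ ∃ n₀ : ℕ, ∀ n : ℕ, n₀ ≤ n →
      ∀ decode : List Bool → Mechanism n,
        ∃ D : PMF (BuyerValuation n),
          (∀ v ∈ D.support, v.IsXOS ∧ 1 ≤ v.val Finset.univ ∧ v.val Finset.univ ≤ (n : ℝ≥0)) ∧
          ∀ w : List Bool,
            (w.length : ℝ) ≤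
                δ * (1 / Real.sqrt (n : ℝ) *
                  (2 : ℝ) ^ ((2 : ℝ) ^ ((n : ℝ) ^ (1 / 4 : ℝ) / 4))) →
              ENNReal.ofReal (c * Real.log (n : ℝ)) * (decode w).revenue D ≤ buyManyRev D := by
  refine ⟨1 / 2048, 1, by norm_num, one_pos, 256, fun n hn decode => ?_⟩
  obtain ⟨K, hK, hKn, hnK⟩ : ∃ K, K ≠ 0 ∧ 256 ^ K ≤ n ∧ n < 256 ^ (K + 1) :=
    ⟨Nat.log 256 n, (Nat.log_pos (by norm_num) hn).ne', Nat.pow_log_le_self _ (by omega),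
      Nat.lt_pow_succ_log_self (by norm_num) n⟩
  have hbound := doublyExp_bound_le hK hKn hnK
  have hsize := sixteen_le_design_size hK
  obtain ⟨ι, C, X, hC, hX, hXX⟩ := exists_design hK hKn
  -- From here N and the bit bound B enter only through B ≤ N/2^K and 16 ≤ N/2^K.
  generalize (2 ^ (2 * K * 4 ^ K)) ^ 2 ^ (2 * K * 4 ^ K - K - 1) = N at *
  generalize 1 / Real.sqrt (n : ℝ) * (2 : ℝ) ^ ((2 : ℝ) ^ ((n : ℝ) ^ (1 / 4 : ℝ) / 4)) = B at *
  have hN0 : N ≠ 0 := by rintro rfl; norm_num at hsize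
  have hne : Nonempty (Fin N) := ⟨⟨0, Nat.pos_of_ne_zero hN0⟩⟩
  have hNpos : (0 : ℝ) < N := by exact_mod_cast Nat.pos_of_ne_zero hN0
  have hK1 : (1 : ℝ) ≤ K := by exact_mod_cast Nat.one_le_iff_ne_zero.2 hK
  let V : Fin N → ℕ → BuyerValuation n := fun i a =>
    BuyerValuation.coverage C (X i) (2 ^ a / 2 ^ (4 * K))
  have hVfull : ∀ i a x, x ∈ X i → ∀ S, C x ⊆ S → (V i a).val S = 2 ^ a := by
    intro i a x hx S hS
    rw [BuyerValuation.coverage_eq_of_subset hC _ hx hS]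
    push_cast
    field_simp
  have hVuniv : ∀ i a, (V i a).val Finset.univ = 2 ^ a := fun i a =>
    hVfull i a _ (hX i).choose_spec _ (Finset.subset_univ _)
  have hVscale : ∀ i a S, (V i a).val S = 2 ^ a * (V i 0).val S := by
    intro i a S
    simp only [V, BuyerValuation.coverage_val, NNReal.mul_finset_sup, pow_zero]
    refine Finset.sup_congr rfl fun x _ => ?_
    ring
  have hpay : ∀ (M : Mechanism n) i a, (M.payment (V i a)).toReal ≤ 2 ^ a := by
    intro M i a
    have := ENNReal.toReal_mono ENNReal.coe_ne_top (M.payment_le (V i a))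
    rw [hVuniv] at this
    simpa using this
  obtain ⟨μ, hμ0, hμle, hμ1, hμm⟩ := exists_geometric_weights hK
  have hμdiv : ∀ j (P : ℝ), 0 ≤ P → μ j * P ≤ P / 2 ^ (j : ℕ) := fun j P hP => by
    rw [div_eq_mul_one_div, mul_comm]
    exact mul_le_mul_of_nonneg_left (hμle j) hP
  have hpow : ∀ j : Fin K, (2 : ℝ) ^ (j : ℕ) ≤ 2 ^ K := fun j =>
    pow_le_pow_right₀ (by norm_num) j.2.le
  -- `W` lists all descriptions of at most N/2^K bits. H = 2^K caps payments and scales, a = 4 is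
  -- the single-parameter bound (usable as μ j ≤ 1/2^j), and m = K/2 is the mean scale.
  obtain ⟨σ, hσ1, hσ2⟩ := exists_selection (I := Fin N)
    (W := Σ k : Fin (⌊N / (2 : ℝ) ^ K⌋₊ + 1), (Fin k → Bool)) hμ0 hμ1
    (H := 2 ^ K) (a := 4) (m := K / 2) (by positivity)
    (fun w i j => ((decode (List.ofFn w.2)).payment (V i j)).toReal)
    (fun w i j => ENNReal.toReal_nonneg)
    (fun w i j => (hpay _ i j).trans (hpow j))
    (fun w i => by
      refine le_trans ?_ ((decode (List.ofFn w.2)).sum_payment_div_le (V i 0)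
        (by rw [hVuniv, pow_zero]) (V i) (hVscale i) K)
      rw [← Fin.sum_univ_eq_sum_range
        (fun j => ((decode (List.ofFn w.2)).payment (V i j)).toReal / 2 ^ j)]
      refine Finset.sum_le_sum fun j _ => ?_
      exact hμdiv j _ ENNReal.toReal_nonneg)
    (fun j => 2 ^ (j : ℕ)) (fun j => by positivity) hpow hμm
    (by
      have hcard := card_words_le ⌊N / (2 : ℝ) ^ K⌋₊
      have hfl := Nat.floor_le (show 0 ≤ N / (2 : ℝ) ^ K by positivity)
      have e1 : (N : ℝ) * (2 * 4 / 2 ^ K) = 8 * (N / 2 ^ K) := by ring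
      have e2 : (N : ℝ) * (K / 2 / (4 * 2 ^ K)) = K * (N / 2 ^ K) / 8 := by field_simp; norm_num
      have hhalf : Real.exp (-1) < 1 / 2 := by
        rw [Real.exp_neg, one_div]
        exact inv_strictAnti₀ two_pos (by linarith [Real.exp_one_gt_d9])
      rw [Fintype.card_fin, e1, e2]
      set R : ℝ := N / 2 ^ K
      have h1 : (Fintype.card (Σ k : Fin (⌊R⌋₊ + 1), (Fin k → Bool)) : ℝ) *
          Real.exp (-(8 * R)) ≤ Real.exp (-1) := by
        refine (mul_le_mul_of_nonneg_right hcard (Real.exp_pos _).le).trans ?_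
        rw [← Real.exp_add]
        -- With R = N/2^K, at most e^(R+1) words stand against a tail e^(-8R).
        exact Real.exp_le_exp.2 (by linarith)
      have h2 : Real.exp (-(K * R / 8)) ≤ Real.exp (-1) :=
        Real.exp_le_exp.2 (by nlinarith)
      linarith)
  rw [Fintype.card_fin] at hσ1 hσ2
  refine ⟨(PMF.uniformOfFintype (Fin N)).map fun i => V i (σ i), ?_, fun w hw => ?_⟩
  · intro v hv
    obtain ⟨i, -, rfl⟩ := (PMF.mem_support_map_iff _ _ _).1 hv
    refine ⟨BuyerValuation.coverage_isXOS _ _ _, ?_, ?_⟩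
    · rw [hVuniv]; exact one_le_pow₀ one_le_two
    · rw [hVuniv]
      have : 2 ^ (σ i : ℕ) ≤ n :=
        (Nat.pow_le_pow_right two_pos (σ i).2.le).trans
          ((Nat.pow_le_pow_left (by norm_num) _).trans hKn)
      exact_mod_cast this
  -- The price is the full value of the type, which therefore breaks even exactly.
  · let l : Fin N → Lottery n := fun i => Lottery.uniform C (X i) (hX i) (2 ^ (σ i : ℕ))
    have hl : ∀ i, (l i).utility (V i (σ i)) = 0 := by
      intro i
      have hpos : (0 : ℝ) < (X i).card := by exact_mod_cast (hX i).card_pos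
      rw [Lottery.uniform_utility, Finset.sum_congr rfl fun x hx => by
        rw [hVfull i (σ i) x hx (C x) subset_rfl]]
      rw [Finset.sum_const, nsmul_eq_mul]
      field_simp
      simp
    refine le_trans ?_ (le_buyManyRev (fun i => V i (σ i)) l
      (fun i => BuyerValuation.coverage_empty _ _ _)
      (fun i => BuyerValuation.coverage_union_le _ _ _) hl fun i j => ?_)
    · rw [Mechanism.revenue_map_uniform, mul_left_comm]
      refine mul_le_mul_right ?_ _
      have hlen : w.length < ⌊N / (2 : ℝ) ^ K⌋₊ + 1 :=
        Nat.lt_succ_of_le (Nat.le_floor (hw.trans (by linarith)))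
      have hw' := hσ1 ⟨⟨w.length, hlen⟩, w.get⟩
      simp only [List.ofFn_get] at hw'
      have hlog := log_le_of_lt_pow hK (by omega : n ≠ 0) hnK
      have hlog0 : 0 ≤ Real.log n := Real.log_natCast_nonneg n
      have e1 : ∑ i, (decode w).payment (V i (σ i)) =
          ENNReal.ofReal (∑ i, ((decode w).payment (V i (σ i))).toReal) := by
        rw [← ENNReal.toReal_sum fun i _ => Mechanism.payment_ne_top _ _, ENNReal.ofReal_toReal]
        exact ENNReal.sum_ne_top.2 fun i _ => Mechanism.payment_ne_top _ _
      have e2 : ∑ i, ((l i).price : ℝ≥0∞) = ENNReal.ofReal (∑ i, (2 : ℝ) ^ (σ i : ℕ)) := by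
        rw [ENNReal.ofReal_sum_of_nonneg fun i _ => by positivity]
        refine Finset.sum_congr rfl fun i _ => ?_
        rw [ENNReal.ofReal_pow zero_le_two]
        simp [l, Lottery.uniform]
      rw [e1, e2, ← ENNReal.ofReal_mul (by positivity)]
      refine ENNReal.ofReal_le_ofReal (le_trans ?_ hσ2)
      -- The constant 1/2048 suffices because 12 · 16 / 2048 < 1/8.
      calc 1 / 2048 * Real.log n * ∑ i, ((decode w).payment (V i (σ i))).toReal
          ≤ 1 / 2048 * (12 * K) * (N * (4 * 4)) := by gcongr
        _ ≤ N * (K / 2 / 4) := by nlinarith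
    · rcases eq_or_ne i j with rfl | hij
      · exact (hl i).le
      · have hpos : (0 : ℝ) < (X j).card := by exact_mod_cast (hX j).card_pos
        rw [Lottery.uniform_utility]
        -- A foreign lottery is worth at most 1 in expectation, and every price is at least 1.
        have h1 := (div_le_one hpos).2 (hXX i j hij (σ i) (σ i).2)
        have h2 : (1 : ℝ) ≤ ((2 ^ (σ j : ℕ) : ℝ≥0) : ℝ) := by
          push_cast; exact one_le_pow₀ one_le_two
        linarith
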